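/- A dyadic grid on $\mathbb R$ is a collection $\mathcal D$ of intervals such that every $I\in\mathcal D$ has length $|I|=2^k$ for some $k\in\mathbb Z$, for each $k\in\mathbb Z$ the intervals in $\mathcal D$ of length $2^k$ form a partition of $\mathbb R$, and $I\cap J\in\{\varnothing,I,J\}$ for all $I,J\in\mathcal D$. For $I\in\mathcal D$ with left half $I_-$ and right half $I_+$ let $h_I=|I|^{-1/2}(\mathbf 1_{I_+}-\mathbf 1_{I_-})$ be the Haar function, and for real-valued $f\in L^2(\mathbb R)$ write $(f,h_I)=\int_{\mathbb R} f\,h_I\,dx$. For $s>0$ let $$D^s_{\mathcal D}f=\sum_{I\in\mathcal D}|I|^{-s}(f,h_I)\,h_I ,\qquad H^s_{\mathcal D}(\mathbb R)=\{f\in L^2(\mathbb R): D^s_{\mathcal D}f\in L^2(\mathbb R)\},$$ where $D^s_{\mathcal D}f\in L^2(\mathbb R)$ means that the series converges unconditionally in $L^2(\mathbb R)$, and $$\|f\|_{H^s_{\mathcal D}}=\big(\|D^s_{\mathcal D}f\|_{L^2}^2+\|f\|_{L^2}^2\big)^{1/2}.$$ **Proposition.** Let $1/2<s<1$. Then for every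 dyadic grid $\mathcal D$ the space $H^s_{\mathcal D}(\mathbb R)$ is an algebra under pointwise multiplication: if $f\in H^s_{\mathcal D}(\mathbb R)$ then $f^2\in H^s_{\mathcal D}(\mathbb R)$, and if $f_1,f_2\in H^s_{\mathcal D}(\mathbb R)$ then $f_1f_2\in H^s_{\mathcal D}(\mathbb R)$. Moreover there is a constant $C_s>0$ depending only on $s$ (not on $\mathcal D$ or $f$) such that $$\|f^2\|_{H^s_{\mathcal D}}\le C_s\,\|f\|_{H^s_{\mathcal D}}^2\qquad\text{for all } f\in H^s_{\mathcal D}(\mathbb R).$$ -/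

import Mathlib

open MeasureTheory

/-- A dyadic grid on `ℝ`: a collection of intervals of dyadic lengths such that, for each `k : ℤ`,
those of length `2 ^ k` partition `ℝ`, and any two are disjoint or nested. -/
structure DyadicGrid where
  intervals : Set (Set ℝ)
  interval_of_mem : ∀ I ∈ intervals, I.OrdConnected
  length_of_mem : ∀ I ∈ intervals, ∃ k : ℤ, volume I = ENNReal.ofReal ((2 : ℝ) ^ k)
  partition : ∀ k : ℤ,
    Setoid.IsPartition {I | I ∈ intervals ∧ volume I = ENNReal.ofReal ((2 : ℝ) ^ k)}
  nested : ∀ I ∈ intervals, ∀ J ∈ intervals, I ∩ J = ∅ ∨ I ∩ J = I ∨ I ∩ J = J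

namespace DyadicGrid

noncomputable section

/-- The midpoint of a bounded interval. -/
def midpt (I : Set ℝ) : ℝ := (sInf I + sSup I) / 2

/-- The left half of an interval. The midpoint is put in neither half: it is a null set,
and Haar functions are only used as elements of `L²`. -/
def leftHalf (I : Set ℝ) : Set ℝ := I ∩ Set.Iio (midpt I)

/-- The right half of an interval. -/
def rightHalf (I : Set ℝ) : Set ℝ := I ∩ Set.Ioi (midpt I)

/-- The Haar function `h_I = |I|^{-1/2} (1_{I_+} - 1_{I_-})`. -/
def haar (I : Set ℝ) (x : ℝ) : ℝ :=
  (Real.sqrt (volume.real I))⁻¹ *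
    ((rightHalf I).indicator (fun _ => (1 : ℝ)) x - (leftHalf I).indicator (fun _ => (1 : ℝ)) x)

theorem memLp_haar (D : DyadicGrid) (I : D.intervals) : MemLp (haar (I : Set ℝ)) 2 volume := by
  obtain ⟨k, hk⟩ := D.length_of_mem I I.2
  have hm : MeasurableSet (I : Set ℝ) := (D.interval_of_mem I I.2).measurableSet
  have hfin : volume (I : Set ℝ) ≠ ⊤ := by rw [hk]; exact ENNReal.ofReal_ne_top
  have h1 : MemLp ((rightHalf (I : Set ℝ)).indicator (fun _ => (1 : ℝ))) 2 volume :=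
    memLp_indicator_const 2 (hm.inter measurableSet_Ioi) 1
      (Or.inr (measure_ne_top_of_subset Set.inter_subset_left hfin))
  have h2 : MemLp ((leftHalf (I : Set ℝ)).indicator (fun _ => (1 : ℝ))) 2 volume :=
    memLp_indicator_const 2 (hm.inter measurableSet_Iio) 1
      (Or.inr (measure_ne_top_of_subset Set.inter_subset_left hfin))
  exact (h1.sub h2).const_mul _

/-- The Haar function `h_I` as an element of `L²(ℝ)`. -/
def haarLp (D : DyadicGrid) (I : D.intervals) : Lp ℝ 2 (volume : Measure ℝ) :=
  (D.memLp_haar I).toLp (haar (I : Set ℝ))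

/-- The Haar coefficient `(f, h_I) = ∫ f h_I`. -/
def haarCoeff (f : Lp ℝ 2 (volume : Measure ℝ)) (I : Set ℝ) : ℝ := ∫ x, f x * haar I x

/-- The term `|I|^{-s} (f, h_I) h_I` of the series defining the dyadic fractional derivative. -/
def fracDerivTerm (D : DyadicGrid) (s : ℝ) (f : Lp ℝ 2 (volume : Measure ℝ)) (I : D.intervals) :
    Lp ℝ 2 (volume : Measure ℝ) :=
  (volume.real (I : Set ℝ) ^ (-s) * haarCoeff f I) • D.haarLp I

/-- The dyadic fractional derivative `D^s f = ∑_I |I|^{-s} (f, h_I) h_I`, the sum being taken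
in `L²(ℝ)`. It is meaningful for `f` in `D.sobolev s`. -/
def fracDeriv (D : DyadicGrid) (s : ℝ) (f : Lp ℝ 2 (volume : Measure ℝ)) :
    Lp ℝ 2 (volume : Measure ℝ) :=
  ∑' I : D.intervals, D.fracDerivTerm s f I

theorem haarCoeff_eq_inner (D : DyadicGrid) (f : Lp ℝ 2 (volume : Measure ℝ)) (I : D.intervals) :
    haarCoeff f I = inner ℝ (D.haarLp I) f := by
  rw [L2.inner_def, haarCoeff]
  refine integral_congr_ae ?_
  filter_upwards [(D.memLp_haar I).coeFn_toLp] with x hx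
  simp [haarLp, hx]

/-- The dyadic fractional Sobolev space: all `f ∈ L²(ℝ)` for which `D^s f` is in `L²(ℝ)`, that is,
for which the series defining `D^s f` converges (unconditionally) in `L²(ℝ)`. -/
def sobolev (D : DyadicGrid) (s : ℝ) : Submodule ℝ (Lp ℝ 2 (volume : Measure ℝ)) where
  carrier := {f | Summable (D.fracDerivTerm s f)}
  zero_mem' := by
    have h : D.fracDerivTerm s 0 = fun _ => 0 := by
      funext I
      simp [fracDerivTerm, haarCoeff_eq_inner]
    change Summable (D.fracDerivTerm s 0)
    rw [h]
    exact summable_zero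
  add_mem' := by
    intro f g hf hg
    have h : D.fracDerivTerm s (f + g) = fun I => D.fracDerivTerm s f I + D.fracDerivTerm s g I := by
      funext I
      simp [fracDerivTerm, haarCoeff_eq_inner, inner_add_right, mul_add, add_smul]
    change Summable (D.fracDerivTerm s (f + g))
    rw [h]
    exact Summable.add hf hg
  smul_mem' := by
    intro c f hf
    have h : D.fracDerivTerm s (c • f) = fun I => c • D.fracDerivTerm s f I := by
      funext I
      simp only [fracDerivTerm, haarCoeff_eq_inner, inner_smul_right, smul_smul]
      congr 1
      ring
    change Summable (D.fracDerivTerm s (c • f))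
    rw [h]
    exact Summable.const_smul c hf

/-- The norm `(‖D^s f‖² + ‖f‖²)^{1/2}` of `f` in `D.sobolev s`, with `L²` norms on the right. -/
def sobolevNorm (D : DyadicGrid) (s : ℝ) (f : Lp ℝ 2 (volume : Measure ℝ)) : ℝ :=
  Real.sqrt (‖D.fracDeriv s f‖ ^ 2 + ‖f‖ ^ 2)

end

end DyadicGrid

/-! The Haar system is an orthonormal basis of `L²`, so `‖D^s f‖² = ∑_I |I|^{-2s} (f, h_I)²` and
membership in the space is the finiteness of this sum.

Such an `f` is bounded. Passing from an interval `J` to one of its halves changes the average of `f`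
by `|J|^{-1/2} |(f, h_J)| ≤ |J|^{s-1/2} ‖D^s f‖`. For `s > 1/2` these steps form a convergent
geometric series below scale `1`, where the average is at most `‖f‖`; Lebesgue differentiation then
bounds `|f|` (`ae_abs_le`).

If `|f| ≤ M` and `a` is the average of `f` on `I`, then `(f², h_I) = ∫_I (f - a)(f + a) h_I` because
`h_I` has mean zero, whence `|(f², h_I)| ≤ 2M ‖(f - a) 1_I‖` (`abs_haarCoeff_sq_le`). By Parseval
`‖(f - a) 1_I‖² = ∑_{J ⊆ I} (f, h_J)²`. After weighting by `|I|^{-2s}` and exchanging the sums, the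
factor `∑_{I ⊇ J} |I|^{-2s} = |J|^{-2s} / (1 - 2^{-2s})` restores `‖D^s f‖²`
(`tsum_weighted_oscillation_le`). Products follow by polarization. -/

namespace DyadicGrid

/-! ### Intervals of finite length. -/

section OrdConnected

variable {I : Set ℝ}

theorem bddAbove_of_ordConnected (hI : I.OrdConnected) (hv : volume I ≠ ⊤) : BddAbove I := by
  by_contra h
  rcases I.eq_empty_or_nonempty with rfl | ⟨x, hx⟩
  · exact h bddAbove_empty
  apply hv
  rw [← top_le_iff, ← Real.volume_Ici (a := x)]
  refine measure_mono fun y hy => ?_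
  obtain ⟨z, hz, hyz⟩ := not_bddAbove_iff.1 h y
  exact hI.out hx hz ⟨hy, hyz.le⟩

theorem bddBelow_of_ordConnected (hI : I.OrdConnected) (hv : volume I ≠ ⊤) : BddBelow I := by
  by_contra h
  rcases I.eq_empty_or_nonempty with rfl | ⟨x, hx⟩
  · exact h bddBelow_empty
  apply hv
  rw [← top_le_iff, ← Real.volume_Iic (a := x)]
  refine measure_mono fun y hy => ?_
  obtain ⟨z, hz, hyz⟩ := not_bddBelow_iff.1 h y
  exact hI.out hz hx ⟨hyz.le, hy⟩

/-- Grid intervals may or may not contain their endpoints; only this null ambiguity separates them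
from closed intervals. -/
theorem ae_eq_Icc_of_ordConnected (hI : I.OrdConnected) (hne : I.Nonempty) (hv : volume I ≠ ⊤) :
    I =ᵐ[volume] Set.Icc (sInf I) (sSup I) := by
  have h1 : I ⊆ Set.Icc (sInf I) (sSup I) :=
    subset_Icc_csInf_csSup (bddBelow_of_ordConnected hI hv) (bddAbove_of_ordConnected hI hv)
  have h2 : Set.Ioo (sInf I) (sSup I) ⊆ I := by
    rintro x ⟨hx1, hx2⟩
    obtain ⟨y, hy, hyx⟩ := exists_lt_of_csInf_lt hne hx1
    obtain ⟨z, hz, hxz⟩ := exists_lt_of_lt_csSup hne hx2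
    exact hI.out hy hz ⟨hyx.le, hxz.le⟩
  exact h1.eventuallyLE.antisymm (Ioo_ae_eq_Icc.symm.le.trans h2.eventuallyLE)

theorem volumeReal_of_ordConnected (hI : I.OrdConnected) (hne : I.Nonempty)
    (hv : volume I ≠ ⊤) : volume.real I = sSup I - sInf I := by
  rw [measureReal_congr (ae_eq_Icc_of_ordConnected hI hne hv), Real.volume_real_Icc_of_le]
  exact csInf_le_csSup hne (bddBelow_of_ordConnected hI hv) (bddAbove_of_ordConnected hI hv)

end OrdConnected

/-! ### Nesting and halves of grid intervals. -/

variable (D : DyadicGrid) {I J : Set ℝ}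

theorem volume_ne_top (hI : I ∈ D.intervals) : volume I ≠ ⊤ := by
  obtain ⟨k, hk⟩ := D.length_of_mem I hI
  rw [hk]
  exact ENNReal.ofReal_ne_top

theorem measurableSet_of_mem (hI : I ∈ D.intervals) : MeasurableSet I :=
  (D.interval_of_mem I hI).measurableSet

theorem exists_level (hI : I ∈ D.intervals) : ∃ k : ℤ, volume.real I = 2 ^ k := by
  obtain ⟨k, hk⟩ := D.length_of_mem I hI
  exact ⟨k, by rw [Measure.real, hk, ENNReal.toReal_ofReal (by positivity)]⟩

theorem volumeReal_pos (hI : I ∈ D.intervals) : 0 < volume.real I := by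
  obtain ⟨k, hk⟩ := D.exists_level hI
  rw [hk]
  positivity

theorem volume_eq_of_real (hI : I ∈ D.intervals) {r : ℝ} (h : volume.real I = r) :
    volume I = ENNReal.ofReal r := by
  rw [← h, Measure.real, ENNReal.ofReal_toReal (D.volume_ne_top hI)]

theorem nonempty_of_mem (hI : I ∈ D.intervals) : I.Nonempty := by
  by_contra h
  have := D.volumeReal_pos hI
  simp [Set.not_nonempty_iff_eq_empty.1 h] at this

theorem exists_cell (k : ℤ) (x : ℝ) : ∃ I ∈ D.intervals, volume.real I = 2 ^ k ∧ x ∈ I := by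
  obtain ⟨I, ⟨⟨hI, hv⟩, hx⟩, -⟩ := (D.partition k).2 x
  exact ⟨I, hI, by rw [Measure.real, hv, ENNReal.toReal_ofReal (by positivity)], hx⟩

theorem eq_of_volume_eq (hI : I ∈ D.intervals) (hJ : J ∈ D.intervals)
    (h : volume.real I = volume.real J) {x : ℝ} (hxI : x ∈ I) (hxJ : x ∈ J) : I = J := by
  obtain ⟨k, hk⟩ := D.exists_level hJ
  exact ((D.partition k).2 x).unique ⟨⟨hI, D.volume_eq_of_real hI (h.trans hk)⟩, hxI⟩
    ⟨⟨hJ, D.volume_eq_of_real hJ hk⟩, hxJ⟩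

theorem volumeReal_mono (hJ : J ∈ D.intervals) (h : I ⊆ J) : volume.real I ≤ volume.real J :=
  measureReal_mono h (D.volume_ne_top hJ)

/-- An interval meeting another one that is at least as long is contained in it. -/
theorem subset_of_volume_le (hI : I ∈ D.intervals) (hJ : J ∈ D.intervals)
    (h : volume.real I ≤ volume.real J) {x : ℝ} (hxI : x ∈ I) (hxJ : x ∈ J) : I ⊆ J := by
  rcases D.nested I hI J hJ with h0 | h0 | h0
  · exact absurd (show x ∈ I ∩ J from ⟨hxI, hxJ⟩) (by simp [h0])
  · exact Set.inter_eq_left.1 h0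
  · have hJI : J ⊆ I := Set.inter_eq_right.1 h0
    exact (D.eq_of_volume_eq hI hJ (h.antisymm (D.volumeReal_mono hI hJI)) hxI hxJ).subset

theorem lt_of_disjoint_of_lt {A B : Set ℝ} (hA : A.OrdConnected) (hB : B.OrdConnected)
    (h : Disjoint A B) {x y : ℝ} (hx : x ∈ A) (hy : y ∈ B) (hxy : x < y) :
    ∀ a ∈ A, ∀ b ∈ B, a < b := by
  intro a ha b hb
  by_contra! hba
  rw [Set.disjoint_left] at h
  rcases le_total a y with h1 | h1
  · exact h ha (hB.out hb hy ⟨hba, h1⟩)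
  · exact h (hA.out hx ha ⟨hxy.le, h1⟩) hy

/-- `L` and `R` are the two halves of `J` in the grid. -/
structure IsChildren (J L R : Set ℝ) : Prop where
  left_mem : L ∈ D.intervals
  right_mem : R ∈ D.intervals
  volume_left : volume.real L = volume.real J / 2
  volume_right : volume.real R = volume.real J / 2
  disjoint : Disjoint L R
  union_eq : L ∪ R = J
  lt : ∀ a ∈ L, ∀ b ∈ R, a < b

theorem exists_children (hJ : J ∈ D.intervals) : ∃ L R, D.IsChildren J L R := by
  obtain ⟨k, hk⟩ := D.exists_level hJ
  have h2 : (2 : ℝ) ^ (k - 1) = volume.real J / 2 := by rw [hk, zpow_sub_one₀ two_ne_zero]; ring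
  have hpos := D.volumeReal_pos hJ
  have hex : ∀ x ∈ J, ∃ K ∈ D.intervals, volume.real K = volume.real J / 2 ∧ x ∈ K ∧ K ⊆ J := by
    intro x hx
    obtain ⟨K, hK, hKv, hxK⟩ := D.exists_cell (k - 1) x
    rw [h2] at hKv
    exact ⟨K, hK, hKv, hxK, D.subset_of_volume_le hK hJ (by linarith) hxK hx⟩
  have hdis : ∀ A ∈ D.intervals, ∀ B ∈ D.intervals, volume.real A = volume.real J / 2 →
      volume.real B = volume.real J / 2 → ∀ y ∈ B, y ∉ A → Disjoint A B := by
    intro A hA B hB hAv hBv y hyB hyA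
    rw [Set.disjoint_left]
    intro z hzA hzB
    rw [D.eq_of_volume_eq hA hB (hAv.trans hBv.symm) hzA hzB] at hyA
    exact hyA hyB
  obtain ⟨x, hx⟩ := D.nonempty_of_mem hJ
  obtain ⟨A, hA, hAv, hxA, hAJ⟩ := hex x hx
  obtain ⟨y, hyJ, hyA⟩ : ∃ y ∈ J, y ∉ A := by
    by_contra! h
    have := D.volumeReal_mono hA (show J ⊆ A from h)
    linarith
  obtain ⟨B, hB, hBv, hyB, hBJ⟩ := hex y hyJ
  have hAB := hdis A hA B hB hAv hBv y hyB hyA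
  have hun : A ∪ B = J := by
    refine (Set.union_subset hAJ hBJ).antisymm fun z hz => ?_
    by_contra hzAB
    rw [Set.mem_union, not_or] at hzAB
    -- A third disjoint interval of length `|J| / 2` would not fit into `J`.
    obtain ⟨C, hC, hCv, hzC, hCJ⟩ := hex z hz
    have h1 := hdis A hA C hC hAv hCv z hzC hzAB.1
    have h3 := hdis B hB C hC hBv hCv z hzC hzAB.2
    have h4 : volume.real (A ∪ B ∪ C) = volume.real A + volume.real B + volume.real C := by
      rw [measureReal_union (h1.union_left h3) (D.measurableSet_of_mem hC)
        (measure_union_ne_top (D.volume_ne_top hA) (D.volume_ne_top hB)) (D.volume_ne_top hC),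
        measureReal_union hAB (D.measurableSet_of_mem hB) (D.volume_ne_top hA)
        (D.volume_ne_top hB)]
    have h5 := D.volumeReal_mono hJ (Set.union_subset (Set.union_subset hAJ hBJ) hCJ)
    linarith
  have hxy : x ≠ y := fun h => hyA (h ▸ hxA)
  rcases lt_or_gt_of_ne hxy with h | h
  · exact ⟨A, B, hA, hB, hAv, hBv, hAB, hun,
      lt_of_disjoint_of_lt (D.interval_of_mem A hA) (D.interval_of_mem B hB) hAB hxA hyB h⟩
  · exact ⟨B, A, hB, hA, hBv, hAv, hAB.symm, by rw [Set.union_comm, hun],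
      lt_of_disjoint_of_lt (D.interval_of_mem B hB) (D.interval_of_mem A hA) hAB.symm hyB hxA h⟩

variable {D} {L R : Set ℝ}

/-- `haar` is cut at the midpoint, while the grid supplies only two disjoint ordered pieces. As both
have length `|J| / 2`, the midpoint must lie between `sSup L` and `sInf R`. -/
theorem IsChildren.mem_halves (h : D.IsChildren J L R) :
    L ⊆ Set.Iic (midpt J) ∧ R ⊆ Set.Ici (midpt J) := by
  have hLne := D.nonempty_of_mem h.left_mem
  have hRne := D.nonempty_of_mem h.right_mem
  have hLo := D.interval_of_mem L h.left_mem
  have hRo := D.interval_of_mem R h.right_mem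
  have hLf := D.volume_ne_top h.left_mem
  have hRf := D.volume_ne_top h.right_mem
  have hLb := bddBelow_of_ordConnected hLo hLf
  have hRb := bddBelow_of_ordConnected hRo hRf
  have hLa := bddAbove_of_ordConnected hLo hLf
  have hRa := bddAbove_of_ordConnected hRo hRf
  have hL := volumeReal_of_ordConnected hLo hLne hLf
  have hR := volumeReal_of_ordConnected hRo hRne hRf
  have hle : sSup L ≤ sInf R :=
    csSup_le hLne fun a ha => le_csInf hRne fun b hb => (h.lt a ha b hb).le
  have hv := h.volume_left
  have hw := h.volume_right
  have hJv : volume.real J = volume.real L + volume.real R := by linarith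
  have hLi := csInf_le_csSup hLne hLb hLa
  have hRi := csInf_le_csSup hRne hRb hRa
  have hinf : sInf J = sInf L := by
    rw [← h.union_eq, csInf_union hLb hLne hRb hRne, inf_eq_left]
    linarith
  have hsup : sSup J = sSup R := by
    rw [← h.union_eq, csSup_union hLa hLne hRa hRne, sup_eq_right]
    linarith
  have hm1 : sSup L ≤ midpt J := by rw [midpt, hinf, hsup]; linarith
  have hm2 : midpt J ≤ sInf R := by rw [midpt, hinf, hsup]; linarith
  exact ⟨fun a ha => (le_csSup hLa ha).trans hm1, fun b hb => hm2.trans (csInf_le hRb hb)⟩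

/-- Up to null sets, the Haar function of `J` is given by the children of `J` in the grid. -/
theorem IsChildren.haar_ae_eq (h : D.IsChildren J L R) :
    haar J =ᵐ[volume] fun x => (Real.sqrt (volume.real J))⁻¹ *
      (R.indicator (fun _ => (1 : ℝ)) x - L.indicator (fun _ => (1 : ℝ)) x) := by
  have hne : ∀ᵐ x : ℝ, x ≠ midpt J := by
    simp [ae_iff]
  filter_upwards [hne] with x hx
  have h1 : x ∈ rightHalf J ↔ x ∈ R := by
    rw [rightHalf, ← h.union_eq]
    constructor
    · rintro ⟨hL | hR, hm⟩
      · rw [h.union_eq] at hm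
        exact absurd (Set.mem_Iic.1 (h.mem_halves.1 hL)) (not_le.2 hm)
      · exact hR
    · intro hR
      rw [h.union_eq]
      exact ⟨h.union_eq ▸ Or.inr hR, lt_of_le_of_ne (h.mem_halves.2 hR) hx.symm⟩
  have h2 : x ∈ leftHalf J ↔ x ∈ L := by
    rw [leftHalf, ← h.union_eq]
    constructor
    · rintro ⟨hL | hR, hm⟩
      · exact hL
      · rw [h.union_eq] at hm
        exact absurd (Set.mem_Ici.1 (h.mem_halves.2 hR)) (not_le.2 hm)
    · intro hL
      rw [h.union_eq]
      exact ⟨h.union_eq ▸ Or.inl hL, lt_of_le_of_ne (h.mem_halves.1 hL) hx⟩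
  have h3 : (rightHalf J).indicator (fun _ => (1 : ℝ)) x = R.indicator (fun _ => (1 : ℝ)) x := by
    by_cases hR : x ∈ R <;> simp [hR, h1]
  have h4 : (leftHalf J).indicator (fun _ => (1 : ℝ)) x = L.indicator (fun _ => (1 : ℝ)) x := by
    by_cases hL : x ∈ L <;> simp [hL, h2]
  rw [haar, h3, h4]

/-- Lengths are powers of `2`, so a strictly smaller one is at most half. -/
theorem volume_le_half_of_ssubset (hI : I ∈ D.intervals) (hJ : J ∈ D.intervals)
    (hIJ : I ⊆ J) (hne : I ≠ J) : volume.real I ≤ volume.real J / 2 := by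
  obtain ⟨x, hx⟩ := D.nonempty_of_mem hI
  have hlt : volume.real I < volume.real J :=
    lt_of_le_of_ne (D.volumeReal_mono hJ hIJ)
      fun h => hne (D.eq_of_volume_eq hI hJ h hx (hIJ hx))
  obtain ⟨i, hi⟩ := D.exists_level hI
  obtain ⟨k, hk⟩ := D.exists_level hJ
  rw [hi, hk] at hlt ⊢
  have hik : i ≤ k - 1 := Int.le_sub_one_of_lt ((zpow_lt_zpow_iff_right₀ one_lt_two).1 hlt)
  calc (2 : ℝ) ^ i ≤ 2 ^ (k - 1) := zpow_le_zpow_right₀ one_le_two hik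
    _ = 2 ^ k / 2 := by rw [zpow_sub_one₀ two_ne_zero]; rfl

theorem IsChildren.subset_or_subset (h : D.IsChildren J L R) (hI : I ∈ D.intervals)
    (hJ : J ∈ D.intervals) (hIJ : I ⊆ J) (hne : I ≠ J) : I ⊆ L ∨ I ⊆ R := by
  obtain ⟨x, hx⟩ := D.nonempty_of_mem hI
  have hv := volume_le_half_of_ssubset hI hJ hIJ hne
  have hxJ : x ∈ L ∪ R := h.union_eq ▸ hIJ hx
  exact hxJ.imp (D.subset_of_volume_le hI h.left_mem (hv.trans h.volume_left.ge) hx)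
    (D.subset_of_volume_le hI h.right_mem (hv.trans h.volume_right.ge) hx)

end DyadicGrid

/-! ### Orthonormality of the Haar system. -/

namespace DyadicGrid

variable {D : DyadicGrid} {I J L R : Set ℝ}

theorem haar_eq_zero_of_notMem {x : ℝ} (hx : x ∉ J) : haar J x = 0 := by
  simp [haar, leftHalf, rightHalf, hx]

theorem integrableOn_of_mem (f : Lp ℝ 2 (volume : Measure ℝ)) (hI : I ∈ D.intervals) :
    IntegrableOn f I :=
  integrableOn_Lp_of_measure_ne_top f one_le_two (D.volume_ne_top hI)

theorem IsChildren.integral_mul_haar (h : D.IsChildren J L R) {f : ℝ → ℝ}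
    (hf : IntegrableOn f J) :
    ∫ x, f x * haar J x = (Real.sqrt (volume.real J))⁻¹ *
      ((∫ x in R, f x) - ∫ x in L, f x) := by
  have hL := D.measurableSet_of_mem h.left_mem
  have hR := D.measurableSet_of_mem h.right_mem
  have hfL : IntegrableOn f L := hf.mono_set (h.union_eq ▸ Set.subset_union_left)
  have hfR : IntegrableOn f R := hf.mono_set (h.union_eq ▸ Set.subset_union_right)
  rw [← integral_indicator hL, ← integral_indicator hR,
    ← integral_sub (hfR.integrable_indicator hR) (hfL.integrable_indicator hL),
    ← integral_const_mul]
  refine integral_congr_ae ?_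
  filter_upwards [h.haar_ae_eq] with x hx
  rw [hx]
  by_cases h1 : x ∈ L <;> by_cases h2 : x ∈ R <;> simp [h1, h2, mul_comm]

theorem integral_haar (hJ : J ∈ D.intervals) : ∫ x, haar J x = 0 := by
  obtain ⟨L, R, h⟩ := D.exists_children hJ
  have := h.integral_mul_haar (f := fun _ => 1) (integrableOn_const (D.volume_ne_top hJ))
  simpa [h.volume_left, h.volume_right] using this

/-- The Haar function of `J` is almost everywhere constant on a smaller interval of the grid. -/
theorem haar_ae_const (hI : I ∈ D.intervals) (hJ : J ∈ D.intervals) (hIJ : I ⊆ J) (hne : I ≠ J) :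
    ∃ c : ℝ, ∀ᵐ x, x ∈ I → haar J x = c := by
  obtain ⟨L, R, h⟩ := D.exists_children hJ
  have hd := Set.disjoint_left.1 h.disjoint
  rcases h.subset_or_subset hI hJ hIJ hne with h1 | h1
  · refine ⟨(Real.sqrt (volume.real J))⁻¹ * (0 - 1), ?_⟩
    filter_upwards [h.haar_ae_eq] with x hx hxI
    rw [hx, Set.indicator_of_mem (h1 hxI), Set.indicator_of_notMem (hd (h1 hxI))]
  · refine ⟨(Real.sqrt (volume.real J))⁻¹ * (1 - 0), ?_⟩
    filter_upwards [h.haar_ae_eq] with x hx hxI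
    rw [hx, Set.indicator_of_mem (h1 hxI), Set.indicator_of_notMem fun hL => hd hL (h1 hxI)]

/-- `haar J` is constant on `I`, so it pairs to zero with a mean-zero function living on `I`. This
serves both for orthogonality and for the Haar coefficients of oscillations. -/
theorem integral_mul_haar_of_ssubset (hI : I ∈ D.intervals) (hJ : J ∈ D.intervals) (hIJ : I ⊆ J)
    (hne : I ≠ J) {f : ℝ → ℝ} (hf : ∀ x ∉ I, f x = 0) (h0 : ∫ x, f x = 0) :
    ∫ x, f x * haar J x = 0 := by
  obtain ⟨c, hc⟩ := haar_ae_const hI hJ hIJ hne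
  have : ∫ x, f x * haar J x = ∫ x, f x * c := by
    refine integral_congr_ae ?_
    filter_upwards [hc] with x hx
    by_cases hxI : x ∈ I
    · rw [hx hxI]
    · simp [hf x hxI]
  rw [this, integral_mul_const, h0, zero_mul]

theorem haarLp_coeFn (I : D.intervals) : D.haarLp I =ᵐ[volume] haar (I : Set ℝ) :=
  (D.memLp_haar I).coeFn_toLp

theorem inner_haarLp (I J : D.intervals) :
    inner ℝ (D.haarLp I) (D.haarLp J) = ∫ x, haar (J : Set ℝ) x * haar (I : Set ℝ) x := by
  rw [← haarCoeff_eq_inner, haarCoeff]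
  refine integral_congr_ae ?_
  filter_upwards [haarLp_coeFn J] with x hx
  rw [hx]

theorem norm_haarLp (I : D.intervals) : ‖D.haarLp I‖ = 1 := by
  have hpos := D.volumeReal_pos I.2
  suffices h : inner ℝ (D.haarLp I) (D.haarLp I) = (1 : ℝ) by
    rw [real_inner_self_eq_norm_sq] at h
    nlinarith [norm_nonneg (D.haarLp I)]
  obtain ⟨L, R, h⟩ := D.exists_children I.2
  have hd := Set.disjoint_left.1 h.disjoint
  have h1 : ∫ x, haar (I : Set ℝ) x * haar (I : Set ℝ) x =
      ∫ x, (I : Set ℝ).indicator (fun _ => (volume.real (I : Set ℝ))⁻¹) x := by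
    refine integral_congr_ae ?_
    filter_upwards [h.haar_ae_eq] with x hx
    have hs : (Real.sqrt (volume.real (I : Set ℝ)))⁻¹ * (Real.sqrt (volume.real (I : Set ℝ)))⁻¹ =
        (volume.real (I : Set ℝ))⁻¹ := by
      rw [← mul_inv, Real.mul_self_sqrt hpos.le]
    by_cases hI : x ∈ (I : Set ℝ)
    · rw [Set.indicator_of_mem hI, hx, ← hs]
      rw [← h.union_eq] at hI
      rcases hI with hL | hR
      · rw [Set.indicator_of_mem hL, Set.indicator_of_notMem (hd hL)]
        ring
      · rw [Set.indicator_of_mem hR, Set.indicator_of_notMem fun hL => hd hL hR]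
        ring
    · rw [Set.indicator_of_notMem hI, haar_eq_zero_of_notMem hI, zero_mul]
  rw [inner_haarLp, h1, integral_indicator_const _ (D.measurableSet_of_mem I.2), smul_eq_mul,
    mul_inv_cancel₀ hpos.ne']

theorem inner_haarLp_of_subset (I J : D.intervals) (h : (I : Set ℝ) ⊆ J) (hne : I ≠ J) :
    inner ℝ (D.haarLp I) (D.haarLp J) = (0 : ℝ) := by
  rw [real_inner_comm, inner_haarLp]
  exact integral_mul_haar_of_ssubset I.2 J.2 h (fun h' => hne (Subtype.ext h'))
    (fun x hx => haar_eq_zero_of_notMem hx) (integral_haar I.2)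

theorem orthonormal_haarLp (D : DyadicGrid) : Orthonormal ℝ D.haarLp := by
  refine ⟨norm_haarLp, fun I J hne => ?_⟩
  rcases D.nested I I.2 J J.2 with h | h | h
  · rw [inner_haarLp, integral_eq_zero_of_ae]
    filter_upwards with x
    by_cases hI : x ∈ (I : Set ℝ)
    · have hJ : x ∉ (J : Set ℝ) := fun hJ => Set.notMem_empty x (h ▸ ⟨hI, hJ⟩)
      simp [haar_eq_zero_of_notMem hJ]
    · simp [haar_eq_zero_of_notMem hI]
  · exact inner_haarLp_of_subset I J (Set.inter_eq_left.1 h) hne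
  · rw [real_inner_comm]
    exact inner_haarLp_of_subset J I (Set.inter_eq_right.1 h) hne.symm

/-! ### Averages -/

theorem IsChildren.average_sub (h : D.IsChildren J L R) (hJ : J ∈ D.intervals)
    (f : Lp ℝ 2 (volume : Measure ℝ)) :
    (⨍ x in L, f x) - (⨍ x in J, f x) = -((Real.sqrt (volume.real J))⁻¹ * haarCoeff f J) ∧
    (⨍ x in R, f x) - (⨍ x in J, f x) = (Real.sqrt (volume.real J))⁻¹ * haarCoeff f J := by
  have hpos := D.volumeReal_pos hJ
  have hs : (Real.sqrt (volume.real J))⁻¹ * (Real.sqrt (volume.real J))⁻¹ =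
      (volume.real J)⁻¹ := by
    rw [← mul_inv, Real.mul_self_sqrt hpos.le]
  have hu : ∫ x in J, f x = (∫ x in L, f x) + ∫ x in R, f x := by
    rw [← setIntegral_union h.disjoint (D.measurableSet_of_mem h.right_mem)
      (integrableOn_of_mem f h.left_mem) (integrableOn_of_mem f h.right_mem), h.union_eq]
  rw [haarCoeff, h.integral_mul_haar (integrableOn_of_mem f hJ), ← mul_assoc, hs]
  simp only [setAverage_eq, smul_eq_mul, h.volume_left, h.volume_right, hu]
  constructor <;> field_simp <;> ring

theorem abs_average_child_sub (hI : I ∈ D.intervals) (hJ : J ∈ D.intervals) (hIJ : I ⊆ J)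
    (hv : volume.real I = volume.real J / 2) (f : Lp ℝ 2 (volume : Measure ℝ)) :
    |(⨍ x in I, f x) - (⨍ x in J, f x)| = (Real.sqrt (volume.real J))⁻¹ * |haarCoeff f J| := by
  obtain ⟨L, R, h⟩ := D.exists_children hJ
  have hpos := D.volumeReal_pos hJ
  have hne : I ≠ J := by
    rintro rfl
    linarith
  obtain ⟨x, hx⟩ := D.nonempty_of_mem hI
  have hs : |(Real.sqrt (volume.real J))⁻¹| = (Real.sqrt (volume.real J))⁻¹ :=
    abs_of_nonneg (by positivity)
  rcases h.subset_or_subset hI hJ hIJ hne with h1 | h1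
  · rw [D.eq_of_volume_eq hI h.left_mem (hv.trans h.volume_left.symm) hx (h1 hx),
      (h.average_sub hJ f).1, abs_neg, abs_mul, hs]
  · rw [D.eq_of_volume_eq hI h.right_mem (hv.trans h.volume_right.symm) hx (h1 hx),
      (h.average_sub hJ f).2, abs_mul, hs]

/-- Cauchy–Schwarz against the indicator of `I`. It shows that averages over large intervals tend to
`0`, and it starts the telescoping at scale `1`. -/
theorem abs_average_le (hI : I ∈ D.intervals) (f : Lp ℝ 2 (volume : Measure ℝ)) :
    |⨍ x in I, f x| ≤ (Real.sqrt (volume.real I))⁻¹ * ‖f‖ := by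
  have hpos := D.volumeReal_pos hI
  have hm := D.measurableSet_of_mem hI
  have h1 : |∫ x in I, f x| ≤ Real.sqrt (volume.real I) * ‖f‖ := by
    have h := abs_real_inner_le_norm (indicatorConstLp 2 hm (D.volume_ne_top hI) (1 : ℝ)) f
    rw [L2.inner_indicatorConstLp_one, norm_indicatorConstLp two_ne_zero ENNReal.ofNat_ne_top] at h
    simpa [Real.sqrt_eq_rpow] using h
  rw [setAverage_eq, smul_eq_mul, abs_mul, abs_of_pos (inv_pos.2 hpos)]
  calc (volume.real I)⁻¹ * |∫ x in I, f x|
      ≤ (volume.real I)⁻¹ * (Real.sqrt (volume.real I) * ‖f‖) := by gcongr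
    _ = (Real.sqrt (volume.real I))⁻¹ * ‖f‖ := by
      have hs := Real.sqrt_pos.2 hpos
      nth_rewrite 1 [← Real.mul_self_sqrt hpos.le]
      field_simp

/-! ### Lebesgue differentiation and completeness of the Haar system. -/

/-- The interval of length `2 ^ k` of the grid that contains `x`. -/
noncomputable def cell (D : DyadicGrid) (k : ℤ) (x : ℝ) : Set ℝ := (D.exists_cell k x).choose

theorem cell_mem (D : DyadicGrid) (k : ℤ) (x : ℝ) : D.cell k x ∈ D.intervals :=
  (D.exists_cell k x).choose_spec.1

theorem volume_cell (D : DyadicGrid) (k : ℤ) (x : ℝ) : volume.real (D.cell k x) = 2 ^ k :=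
  (D.exists_cell k x).choose_spec.2.1

theorem mem_cell (D : DyadicGrid) (k : ℤ) (x : ℝ) : x ∈ D.cell k x :=
  (D.exists_cell k x).choose_spec.2.2

theorem cell_eq {k : ℤ} {x : ℝ} (hI : I ∈ D.intervals) (hv : volume.real I = 2 ^ k) (hx : x ∈ I) :
    D.cell k x = I :=
  D.eq_of_volume_eq (D.cell_mem k x) hI ((D.volume_cell k x).trans hv.symm) (D.mem_cell k x) hx

theorem abs_average_cell_sub (D : DyadicGrid) (k : ℤ) (x : ℝ)
    (f : Lp ℝ 2 (volume : Measure ℝ)) :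
    |(⨍ y in D.cell (k - 1) x, f y) - (⨍ y in D.cell k x, f y)| =
      (Real.sqrt (2 ^ k))⁻¹ * |haarCoeff f (D.cell k x)| := by
  have hv : volume.real (D.cell (k - 1) x) = volume.real (D.cell k x) / 2 := by
    rw [volume_cell, volume_cell, zpow_sub_one₀ two_ne_zero]
    rfl
  have hpos := D.volumeReal_pos (D.cell_mem k x)
  rw [abs_average_child_sub (D.cell_mem _ x) (D.cell_mem k x)
    (D.subset_of_volume_le (D.cell_mem _ x) (D.cell_mem k x) (by linarith)
      (D.mem_cell _ x) (D.mem_cell k x)) hv, volume_cell]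

/-- Lebesgue differentiation along the grid. -/
theorem ae_tendsto_average_cell (D : DyadicGrid) (f : Lp ℝ 2 (volume : Measure ℝ)) :
    ∀ᵐ x, Filter.Tendsto (fun n : ℕ => ⨍ y in D.cell (-(n : ℤ)) x, f y) Filter.atTop
      (nhds (f x)) := by
  have hloc : LocallyIntegrable f volume := (Lp.memLp f).locallyIntegrable one_le_two
  -- The cells are balls centred at their midpoints, not at `x`; the parameter `1` admits any centre
  -- within one radius of `x`.
  filter_upwards [IsUnifLocDoublingMeasure.ae_tendsto_average volume hloc 1] with x hx
  have hδ : Filter.Tendsto (fun n : ℕ => (2 : ℝ) ^ (-(n : ℤ)) / 2) Filter.atTop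
      (nhdsWithin 0 (Set.Ioi 0)) := by
    refine tendsto_nhdsWithin_iff.2 ⟨?_, Filter.Eventually.of_forall fun n => ?_⟩
    · have := (tendsto_pow_atTop_nhds_zero_of_lt_one (r := (2 : ℝ)⁻¹) (by norm_num)
        (by norm_num)).div_const 2
      simpa using this
    · exact Set.mem_Ioi.2 (by positivity)
  have hball : ∀ n : ℕ, D.cell (-(n : ℤ)) x =ᵐ[volume]
      Metric.closedBall (midpt (D.cell (-(n : ℤ)) x)) ((2 : ℝ) ^ (-(n : ℤ)) / 2) ∧
      x ∈ Metric.closedBall (midpt (D.cell (-(n : ℤ)) x)) (1 * ((2 : ℝ) ^ (-(n : ℤ)) / 2)) := by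
    intro n
    have hI := D.cell_mem (-(n : ℤ)) x
    have ho := D.interval_of_mem _ hI
    have hf := D.volume_ne_top hI
    have hv := volumeReal_of_ordConnected ho (D.nonempty_of_mem hI) hf
    rw [volume_cell] at hv
    have hIcc : Metric.closedBall (midpt (D.cell (-(n : ℤ)) x)) ((2 : ℝ) ^ (-(n : ℤ)) / 2) =
        Set.Icc (sInf (D.cell (-(n : ℤ)) x)) (sSup (D.cell (-(n : ℤ)) x)) := by
      rw [Real.closedBall_eq_Icc, hv, midpt]
      congr 1 <;> ring
    rw [one_mul, hIcc]
    exact ⟨ae_eq_Icc_of_ordConnected ho (D.nonempty_of_mem hI) hf,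
      subset_Icc_csInf_csSup (bddBelow_of_ordConnected ho hf) (bddAbove_of_ordConnected ho hf)
        (D.mem_cell _ x)⟩
  refine (hx _ _ hδ (Filter.Eventually.of_forall fun n => (hball n).2)).congr fun n => ?_
  rw [setAverage_congr (hball n).1]

/-- With no Haar coefficients, the average around `x` is the same at all scales. It is `0` by going
to large scales and equals `f x` by going to small ones. No common ancestor of two points is needed,
so grids that split the line into two half-lines are covered. -/
theorem eq_zero_of_haarCoeff_eq_zero (f : Lp ℝ 2 (volume : Measure ℝ))
    (h : ∀ I ∈ D.intervals, haarCoeff f I = 0) : f = 0 := by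
  have hstep : ∀ (k : ℤ) (x : ℝ),
      (⨍ y in D.cell (k - 1) x, f y) = ⨍ y in D.cell k x, f y := by
    intro k x
    have := D.abs_average_cell_sub k x f
    rw [h _ (D.cell_mem k x), abs_zero, mul_zero, abs_eq_zero] at this
    linarith
  have hconst : ∀ (n : ℕ) (k : ℤ) (x : ℝ),
      (⨍ y in D.cell k x, f y) = ⨍ y in D.cell (k + n) x, f y := by
    intro n k x
    induction n with
    | zero => simp
    | succ n ih =>
      rw [ih, ← hstep (k + (n + 1 : ℕ)) x, show k + ((n + 1 : ℕ) : ℤ) - 1 = k + n by push_cast; ring]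
  have hzero : ∀ (k : ℤ) (x : ℝ), (⨍ y in D.cell k x, f y) = 0 := by
    intro k x
    have hlim : Filter.Tendsto
        (fun n : ℕ => (Real.sqrt ((2 : ℝ) ^ (k + (n : ℤ))))⁻¹ * ‖f‖) Filter.atTop (nhds 0) := by
      have h1 : Filter.Tendsto (fun n : ℕ => (2 : ℝ) ^ k * 2 ^ n) Filter.atTop Filter.atTop :=
        (tendsto_pow_atTop_atTop_of_one_lt one_lt_two).const_mul_atTop (by positivity)
      have h2 := (Real.tendsto_sqrt_atTop.comp h1).inv_tendsto_atTop.mul_const ‖f‖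
      rw [zero_mul] at h2
      refine h2.congr fun n => ?_
      simp [zpow_add₀]
    refine abs_eq_zero.1 (le_antisymm (ge_of_tendsto' hlim fun n => ?_) (abs_nonneg _))
    rw [hconst n k x]
    have := abs_average_le (D.cell_mem (k + n) x) f
    rwa [volume_cell] at this
  refine Lp.ext ?_
  filter_upwards [D.ae_tendsto_average_cell f, Lp.coeFn_zero ℝ 2 (volume : Measure ℝ)] with x hx h0
  rw [h0]
  simp only [hzero] at hx
  exact tendsto_nhds_unique hx tendsto_const_nhds

/-- The Haar system is a Hilbert basis of `L²(ℝ)`. -/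
noncomputable def haarBasis (D : DyadicGrid) :
    HilbertBasis D.intervals ℝ (Lp ℝ 2 (volume : Measure ℝ)) :=
  HilbertBasis.mkOfOrthogonalEqBot D.orthonormal_haarLp <| by
    rw [Submodule.eq_bot_iff]
    intro f hf
    refine eq_zero_of_haarCoeff_eq_zero (D := D) f fun I hI => ?_
    rw [haarCoeff_eq_inner D f ⟨I, hI⟩]
    exact (Submodule.mem_orthogonal _ _).1 hf _ (Submodule.subset_span ⟨_, rfl⟩)

theorem coe_haarBasis (D : DyadicGrid) : ⇑D.haarBasis = D.haarLp :=
  HilbertBasis.coe_mkOfOrthogonalEqBot _ _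

theorem hasSum_haarCoeff_sq (D : DyadicGrid) (f : Lp ℝ 2 (volume : Measure ℝ)) :
    HasSum (fun I : D.intervals => haarCoeff f I ^ 2) (‖f‖ ^ 2) := by
  have h := D.haarBasis.hasSum_inner_mul_inner f f
  rw [real_inner_self_eq_norm_sq] at h
  refine h.congr_fun fun I => ?_
  rw [coe_haarBasis, real_inner_comm, ← haarCoeff_eq_inner, sq]

end DyadicGrid

/-! ### The Sobolev norm in Haar coefficients. -/

namespace DyadicGrid

variable {D : DyadicGrid} {s : ℝ}

theorem summable_fracDerivTerm_iff (D : DyadicGrid) (s : ℝ) (f : Lp ℝ 2 (volume : Measure ℝ)) :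
    Summable (D.fracDerivTerm s f) ↔
      Summable fun I : D.intervals => (volume.real (I : Set ℝ) ^ (-s) * haarCoeff f I) ^ 2 := by
  have h := D.orthonormal_haarLp.orthogonalFamily.summable_iff_norm_sq_summable
    fun I : D.intervals => volume.real (I : Set ℝ) ^ (-s) * haarCoeff f I
  simp only [Real.norm_eq_abs, sq_abs] at h
  exact h

theorem haarCoeff_fracDeriv {f : Lp ℝ 2 (volume : Measure ℝ)} (hf : f ∈ D.sobolev s)
    (J : D.intervals) :
    haarCoeff (D.fracDeriv s f) J = volume.real (J : Set ℝ) ^ (-s) * haarCoeff f J := by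
  have hsum : HasSum (D.fracDerivTerm s f) (D.fracDeriv s f) := Summable.hasSum hf
  rw [haarCoeff_eq_inner]
  have h := hsum.mapL (innerSL ℝ (D.haarLp J))
  refine h.unique ?_
  convert hasSum_single J fun I hI => ?_ using 1
  · simp [fracDerivTerm, norm_haarLp]
  · simp [fracDerivTerm, D.orthonormal_haarLp.2 hI.symm]

theorem hasSum_norm_fracDeriv_sq {f : Lp ℝ 2 (volume : Measure ℝ)} (hf : f ∈ D.sobolev s) :
    HasSum (fun I : D.intervals => (volume.real (I : Set ℝ) ^ (-s) * haarCoeff f I) ^ 2)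
      (‖D.fracDeriv s f‖ ^ 2) := by
  simpa only [haarCoeff_fracDeriv hf] using D.hasSum_haarCoeff_sq (D.fracDeriv s f)

theorem abs_haarCoeff_le {f : Lp ℝ 2 (volume : Measure ℝ)} (hf : f ∈ D.sobolev s)
    (I : D.intervals) :
    |haarCoeff f I| ≤ volume.real (I : Set ℝ) ^ s * ‖D.fracDeriv s f‖ := by
  have hpos := D.volumeReal_pos I.2
  have h1 := abs_real_inner_le_norm (D.haarLp I) (D.fracDeriv s f)
  rw [← haarCoeff_eq_inner, haarCoeff_fracDeriv hf, norm_haarLp, one_mul, abs_mul,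
    abs_of_pos (Real.rpow_pos_of_pos hpos _), Real.rpow_neg hpos.le,
    inv_mul_le_iff₀ (Real.rpow_pos_of_pos hpos _)] at h1
  exact h1

/-! ### Boundedness of Sobolev functions. -/

theorem two_rpow_lt_one {t : ℝ} (ht : t < 0) : (2 : ℝ) ^ t < 1 :=
  Real.rpow_lt_one_of_one_lt_of_neg one_lt_two ht

theorem abs_average_cell_le (hs : 1 / 2 < s) {f : Lp ℝ 2 (volume : Measure ℝ)}
    (hf : f ∈ D.sobolev s) (n : ℕ) (x : ℝ) :
    |⨍ y in D.cell (-(n : ℤ)) x, f y| ≤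
      ‖f‖ + (1 - (2 : ℝ) ^ (1 / 2 - s))⁻¹ * ‖D.fracDeriv s f‖ := by
  set r : ℝ := (2 : ℝ) ^ (1 / 2 - s) with hr
  have hr0 : 0 < r := Real.rpow_pos_of_pos two_pos _
  have hr1 : r < 1 := two_rpow_lt_one (by linarith)
  have key : |⨍ y in D.cell (-(n : ℤ)) x, f y| ≤
      ‖f‖ + (∑ j ∈ Finset.range n, r ^ j) * ‖D.fracDeriv s f‖ := by
    induction n with
    | zero =>
      -- The cell has length `1`, so the factor `|I|^{-1/2}` disappears.
      have := abs_average_le (D.cell_mem 0 x) f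
      simpa [volume_cell] using this
    | succ n ih =>
      have h1 := D.abs_average_cell_sub (-(n : ℤ)) x f
      have h2 := abs_haarCoeff_le hf ⟨D.cell (-(n : ℤ)) x, D.cell_mem _ x⟩
      -- The increment `|J|^{s-1/2}` at `|J| = 2^{-n}`.
      have hpow : (Real.sqrt ((2 : ℝ) ^ (-(n : ℤ))))⁻¹ * ((2 : ℝ) ^ (-(n : ℤ))) ^ s = r ^ n := by
        rw [hr, Real.sqrt_eq_rpow, ← Real.rpow_neg (by positivity),
          ← Real.rpow_add (by positivity), ← Real.rpow_intCast, ← Real.rpow_mul two_pos.le,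
          ← Real.rpow_natCast, ← Real.rpow_mul two_pos.le]
        congr 1
        push_cast
        ring
      simp only [volume_cell] at h2
      have h3 : |(⨍ y in D.cell (-(n : ℤ) - 1) x, f y) - ⨍ y in D.cell (-(n : ℤ)) x, f y| ≤
          r ^ n * ‖D.fracDeriv s f‖ := by
        rw [h1, ← hpow, mul_assoc]
        gcongr
      rw [Finset.sum_range_succ, add_mul, ← add_assoc,
        show -((n + 1 : ℕ) : ℤ) = -(n : ℤ) - 1 by push_cast; ring]
      have h4 := abs_sub_abs_le_abs_sub (⨍ y in D.cell (-(n : ℤ) - 1) x, f y)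
        (⨍ y in D.cell (-(n : ℤ)) x, f y)
      linarith
  refine key.trans ?_
  gcongr
  rw [← tsum_geometric_of_lt_one hr0.le hr1]
  exact (summable_geometric_of_lt_one hr0.le hr1).sum_le_tsum _ fun _ _ => by positivity

theorem ae_abs_le (hs : 1 / 2 < s) {f : Lp ℝ 2 (volume : Measure ℝ)} (hf : f ∈ D.sobolev s) :
    ∀ᵐ x, |f x| ≤ ‖f‖ + (1 - (2 : ℝ) ^ (1 / 2 - s))⁻¹ * ‖D.fracDeriv s f‖ := by
  filter_upwards [D.ae_tendsto_average_cell f] with x hx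
  exact le_of_tendsto' hx.abs fun n => abs_average_cell_le hs hf n x

/-! ### Oscillations, and Haar coefficients of a square. -/

theorem memLp_indicator_sub (f : Lp ℝ 2 (volume : Measure ℝ)) {I : Set ℝ} (hI : I ∈ D.intervals)
    (a : ℝ) : MemLp (I.indicator fun x => f x - a) 2 volume := by
  have h := ((Lp.memLp f).indicator (D.measurableSet_of_mem hI)).sub
    (memLp_indicator_const 2 (D.measurableSet_of_mem hI) a (Or.inr (D.volume_ne_top hI)))
  rwa [show (I.indicator fun x => f x - a) = I.indicator f - I.indicator fun _ => a from
    Set.indicator_sub I f fun _ => a]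

/-- The oscillation `(f - ⨍_I f) 1_I` of `f` on `I`, as an element of `L²(ℝ)`. -/
noncomputable def oscillation (f : Lp ℝ 2 (volume : Measure ℝ)) (I : D.intervals) :
    Lp ℝ 2 (volume : Measure ℝ) :=
  (memLp_indicator_sub f I.2 (⨍ x in (I : Set ℝ), f x)).toLp _

theorem oscillation_coeFn (f : Lp ℝ 2 (volume : Measure ℝ)) (I : D.intervals) :
    oscillation f I =ᵐ[volume]
      (I : Set ℝ).indicator fun x => f x - ⨍ y in (I : Set ℝ), f y :=
  MemLp.coeFn_toLp _

-- Inside `I`, subtracting a constant is invisible to `h_J`. If `J` strictly contains `I`, then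
-- `h_J` is constant on `I`, where the oscillation has mean zero.
open Classical in
theorem haarCoeff_oscillation (f : Lp ℝ 2 (volume : Measure ℝ)) (I J : D.intervals) :
    haarCoeff (oscillation f I) J = if (J : Set ℝ) ⊆ I then haarCoeff f J else 0 := by
  set a : ℝ := ⨍ y in (I : Set ℝ), f y with ha
  have h1 : haarCoeff (oscillation f I) J =
      ∫ x, (I : Set ℝ).indicator (fun x => f x - a) x * haar (J : Set ℝ) x := by
    refine integral_congr_ae ?_
    filter_upwards [oscillation_coeFn f I] with x hx
    rw [hx]
  rw [h1]
  split_ifs with h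
  · have hint : Integrable fun x => f x * haar (J : Set ℝ) x :=
      (Lp.memLp f).integrable_mul (D.memLp_haar J)
    have hJint : Integrable (haar (J : Set ℝ)) := by
      have hon : IntegrableOn (haar (J : Set ℝ)) J :=
        (integrableOn_of_mem (D.haarLp J) J.2).congr (ae_restrict_of_ae (haarLp_coeFn J))
      exact (integrableOn_iff_integrable_of_support_subset fun x hx => by
        by_contra hxJ
        exact hx (haar_eq_zero_of_notMem hxJ)).1 hon
    have h2 : ∀ x, (I : Set ℝ).indicator (fun x => f x - a) x * haar (J : Set ℝ) x =
        f x * haar (J : Set ℝ) x - a * haar (J : Set ℝ) x := by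
      intro x
      by_cases hx : x ∈ (J : Set ℝ)
      · rw [Set.indicator_of_mem (h hx), sub_mul]
      · simp [haar_eq_zero_of_notMem hx]
    simp only [h2]
    rw [integral_sub hint (hJint.const_mul a), integral_const_mul, integral_haar J.2, mul_zero,
      sub_zero, haarCoeff]
  · rcases D.nested I I.2 J J.2 with h0 | h0 | h0
    · refine integral_eq_zero_of_ae (Filter.Eventually.of_forall fun x => ?_)
      by_cases hI : x ∈ (I : Set ℝ)
      · have hJ : x ∉ (J : Set ℝ) := fun hJ => Set.notMem_empty x (h0 ▸ ⟨hI, hJ⟩)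
        simp [haar_eq_zero_of_notMem hJ]
      · simp [hI]
    · refine integral_mul_haar_of_ssubset I.2 J.2 (Set.inter_eq_left.1 h0)
        (fun hIJ => h hIJ.ge) (fun x hx => Set.indicator_of_notMem hx _) ?_
      rw [integral_indicator (D.measurableSet_of_mem I.2),
        integral_sub (integrableOn_of_mem f I.2) (integrableOn_const (D.volume_ne_top I.2)), ha,
        setAverage_eq]
      have hpos := D.volumeReal_pos I.2
      simp [hpos.ne']
    · exact absurd (Set.inter_eq_right.1 h0) h

open Classical in
theorem hasSum_norm_oscillation_sq (f : Lp ℝ 2 (volume : Measure ℝ)) (I : D.intervals) :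
    HasSum (fun J : D.intervals => if (J : Set ℝ) ⊆ I then haarCoeff f J ^ 2 else 0)
      (‖oscillation f I‖ ^ 2) := by
  have h := D.hasSum_haarCoeff_sq (oscillation f I)
  simpa only [haarCoeff_oscillation, ite_pow, zero_pow two_ne_zero] using h

theorem abs_average_le_of_ae_abs_le {f : Lp ℝ 2 (volume : Measure ℝ)} {M : ℝ}
    (hM : ∀ᵐ x, |f x| ≤ M) {I : Set ℝ} (hI : I ∈ D.intervals) : |⨍ x in I, f x| ≤ M := by
  have hpos := D.volumeReal_pos hI
  have h := norm_setIntegral_le_of_norm_le_const_ae (f := f) (C := M)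
    (D.volume_ne_top hI).lt_top (ae_restrict_of_ae hM)
  rw [setAverage_eq, smul_eq_mul, abs_mul, abs_of_pos (inv_pos.2 hpos), inv_mul_le_iff₀ hpos,
    mul_comm]
  exact h

/-- The Haar coefficients of the square of a bounded function are controlled by its
oscillation. -/
theorem abs_haarCoeff_sq_le {f g : Lp ℝ 2 (volume : Measure ℝ)} {M : ℝ}
    (hM : ∀ᵐ x, |f x| ≤ M) (hg : g =ᵐ[volume] fun x => f x ^ 2) (I : D.intervals) :
    |haarCoeff g I| ≤ 2 * M * ‖oscillation f I‖ := by
  have ha := abs_average_le_of_ae_abs_le hM I.2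
  set a : ℝ := ⨍ y in (I : Set ℝ), f y
  have hw := memLp_indicator_sub g I.2 (a ^ 2)
  -- Replacing `f²` by `(f² - a²) 1_I` costs nothing, as `h_I` lives on `I` and has mean zero.
  have hcoeff : haarCoeff g I = inner ℝ (D.haarLp I) (hw.toLp _) := by
    rw [← haarCoeff_eq_inner, haarCoeff, haarCoeff]
    have hint : Integrable fun x => (hw.toLp _) x * haar (I : Set ℝ) x :=
      (Lp.memLp _).integrable_mul (D.memLp_haar I)
    have hind : MemLp ((I : Set ℝ).indicator fun _ => a ^ 2) 2 volume :=
      memLp_indicator_const 2 (D.measurableSet_of_mem I.2) _ (Or.inr (D.volume_ne_top I.2))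
    have hint' : Integrable fun x => (I : Set ℝ).indicator (fun _ => a ^ 2) x *
        haar (I : Set ℝ) x := hind.integrable_mul (D.memLp_haar I)
    have h0 : ∫ x, (I : Set ℝ).indicator (fun _ => a ^ 2) x * haar (I : Set ℝ) x = 0 := by
      rw [← mul_zero (a ^ 2), ← integral_haar I.2, ← integral_const_mul]
      refine integral_congr_ae (Filter.Eventually.of_forall fun x => ?_)
      by_cases hx : x ∈ (I : Set ℝ)
      · simp [hx]
      · simp [hx, haar_eq_zero_of_notMem hx]
    rw [← add_zero (∫ x, (hw.toLp _) x * haar (I : Set ℝ) x), ← h0, ← integral_add hint hint']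
    refine integral_congr_ae ?_
    filter_upwards [hw.coeFn_toLp] with x hx
    rw [hx]
    by_cases hxI : x ∈ (I : Set ℝ)
    · simp only [Set.indicator_of_mem hxI]
      ring
    · simp [haar_eq_zero_of_notMem hxI]
  have hnorm : ‖hw.toLp _‖ ≤ 2 * M * ‖oscillation f I‖ := by
    refine Lp.norm_le_mul_norm_of_ae_le_mul ?_
    filter_upwards [hw.coeFn_toLp, oscillation_coeFn f I, hg, hM] with x h1 h2 h3 h4
    rw [h1, h2]
    by_cases hxI : x ∈ (I : Set ℝ)
    -- In `f² - a² = (f + a)(f - a)` the first factor is at most `2M`.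
    · rw [Set.indicator_of_mem hxI, Set.indicator_of_mem hxI, h3, sq_sub_sq, norm_mul]
      gcongr
      rw [Real.norm_eq_abs]
      linarith [abs_add_le (f x) a]
    · simp [hxI]
  rw [hcoeff]
  refine (abs_real_inner_le_norm _ _).trans ?_
  rwa [norm_haarLp, one_mul]

/-! ### Summation over all scales. -/

theorem volume_cell_rpow_sq (D : DyadicGrid) (s : ℝ) (k : ℤ) (n : ℕ) (x : ℝ) :
    (volume.real (D.cell (k + n) x) ^ (-s)) ^ 2 =
      ((2 : ℝ) ^ (-2 * s)) ^ n * (((2 : ℝ) ^ k) ^ (-s)) ^ 2 := by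
  rw [volume_cell, zpow_add₀ two_ne_zero, zpow_natCast, Real.mul_rpow (by positivity)
    (by positivity), mul_pow, mul_comm]
  congr 1
  rw [← Real.rpow_natCast, ← Real.rpow_natCast, ← Real.rpow_natCast, ← Real.rpow_mul two_pos.le,
    ← Real.rpow_mul two_pos.le, ← Real.rpow_mul two_pos.le]
  congr 1
  push_cast
  ring

open Classical in
/-- The weights of the intervals containing `J` sum up as a geometric series. -/
theorem tsum_superset_le (hs : 0 < s) (J : D.intervals) :
    ∑' I : D.intervals, (if (J : Set ℝ) ⊆ I then
      ENNReal.ofReal ((volume.real (I : Set ℝ) ^ (-s)) ^ 2) else 0) ≤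
    ENNReal.ofReal ((1 - (2 : ℝ) ^ (-2 * s))⁻¹ * (volume.real (J : Set ℝ) ^ (-s)) ^ 2) := by
  obtain ⟨k, hk⟩ := D.exists_level J.2
  obtain ⟨x, hx⟩ := D.nonempty_of_mem J.2
  set q : ℝ := (2 : ℝ) ^ (-2 * s) with hq
  have hq0 : 0 < q := Real.rpow_pos_of_pos two_pos _
  have hq1 : q < 1 := two_rpow_lt_one (by linarith)
  -- `c n` is the ancestor of `J` by `n` generations; every grid interval containing `J` is one of
  -- these.
  let c : ℕ → D.intervals := fun n => ⟨D.cell (k + n) x, D.cell_mem _ x⟩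
  have hle : ∀ I : D.intervals, (if (J : Set ℝ) ⊆ I then
      ENNReal.ofReal ((volume.real (I : Set ℝ) ^ (-s)) ^ 2) else 0) ≤
      ∑' n : ℕ, if I = c n then ENNReal.ofReal ((volume.real (I : Set ℝ) ^ (-s)) ^ 2) else 0 := by
    intro I
    split_ifs with h
    · obtain ⟨i, hi⟩ := D.exists_level I.2
      have hki : k ≤ i := by
        have := D.volumeReal_mono I.2 h
        rw [hi, hk] at this
        exact (zpow_le_zpow_iff_right₀ one_lt_two).1 this
      obtain ⟨n, rfl⟩ := Int.le.dest hki
      have hIc : I = c n := Subtype.ext (cell_eq I.2 hi (h hx)).symm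
      refine le_trans ?_ (ENNReal.le_tsum n)
      rw [if_pos hIc]
    · exact zero_le
  have hc : ∀ n, ENNReal.ofReal ((volume.real (c n : Set ℝ) ^ (-s)) ^ 2) =
      ENNReal.ofReal (q ^ n * (volume.real (J : Set ℝ) ^ (-s)) ^ 2) := by
    intro n
    rw [hk, hq, ← D.volume_cell_rpow_sq s k n x]
  refine (ENNReal.tsum_le_tsum hle).trans ?_
  rw [ENNReal.tsum_comm]
  simp only [tsum_ite_eq, hc]
  rw [← ENNReal.ofReal_tsum_of_nonneg (fun n => by positivity)
    ((summable_geometric_of_lt_one hq0.le hq1).mul_right _), tsum_mul_right,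
    tsum_geometric_of_lt_one hq0.le hq1]

/-- Returns to real series from `ENNReal`, where double sums may be exchanged without summability
conditions. -/
theorem summable_and_tsum_le_of_tsum_ofReal_le {ι : Type*} {F : ι → ℝ} (hF : ∀ i, 0 ≤ F i) {B : ℝ}
    (hB : 0 ≤ B) (h : ∑' i, ENNReal.ofReal (F i) ≤ ENNReal.ofReal B) :
    Summable F ∧ ∑' i, F i ≤ B := by
  have hfin : ∀ u : Finset ι, ∑ i ∈ u, F i ≤ B := by
    intro u
    rw [← ENNReal.ofReal_le_ofReal_iff hB, ENNReal.ofReal_sum_of_nonneg fun i _ => hF i]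
    exact (ENNReal.sum_le_tsum u).trans h
  exact ⟨summable_of_sum_le hF hfin, Real.tsum_le_of_sum_le hF hfin⟩

theorem tsum_weighted_oscillation_le (hs : 0 < s) {f : Lp ℝ 2 (volume : Measure ℝ)}
    (hf : f ∈ D.sobolev s) :
    ∑' I : D.intervals,
      ENNReal.ofReal ((volume.real (I : Set ℝ) ^ (-s)) ^ 2 * ‖oscillation f I‖ ^ 2) ≤
    ENNReal.ofReal ((1 - (2 : ℝ) ^ (-2 * s))⁻¹ * ‖D.fracDeriv s f‖ ^ 2) := by
  classical
  have hq1 : (2 : ℝ) ^ (-2 * s) < 1 := two_rpow_lt_one (by linarith)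
  have hK : 0 ≤ (1 - (2 : ℝ) ^ (-2 * s))⁻¹ := inv_nonneg.2 (by linarith)
  have hsum := hasSum_norm_fracDeriv_sq hf
  have hosc : ∀ I : D.intervals,
      ENNReal.ofReal ((volume.real (I : Set ℝ) ^ (-s)) ^ 2 * ‖oscillation f I‖ ^ 2) =
      ∑' J : D.intervals, ENNReal.ofReal (haarCoeff f J ^ 2) * (if (J : Set ℝ) ⊆ I then
        ENNReal.ofReal ((volume.real (I : Set ℝ) ^ (-s)) ^ 2) else 0) := by
    intro I
    have h := hasSum_norm_oscillation_sq f I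
    rw [ENNReal.ofReal_mul (by positivity), ← h.tsum_eq,
      ENNReal.ofReal_tsum_of_nonneg (fun J => by split_ifs <;> positivity) h.summable,
      ← ENNReal.tsum_mul_left]
    refine tsum_congr fun J => ?_
    split_ifs
    · rw [mul_comm]
    · simp
  simp only [hosc]
  rw [ENNReal.tsum_comm, ← hsum.tsum_eq, ← tsum_mul_left,
    ENNReal.ofReal_tsum_of_nonneg (fun J => by positivity) (hsum.summable.mul_left _)]
  refine ENNReal.tsum_le_tsum fun J => ?_
  rw [ENNReal.tsum_mul_left]
  calc _ ≤ ENNReal.ofReal (haarCoeff f J ^ 2) * ENNReal.ofReal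
        ((1 - (2 : ℝ) ^ (-2 * s))⁻¹ * (volume.real (J : Set ℝ) ^ (-s)) ^ 2) := by
        gcongr
        exact tsum_superset_le hs J
    _ = _ := by
        rw [← ENNReal.ofReal_mul (by positivity)]
        congr 1
        ring

/-- The square of a bounded function of `D.sobolev s` is in `D.sobolev s`. -/
theorem sq_mem_sobolev (hs : 0 < s) {f g : Lp ℝ 2 (volume : Measure ℝ)} (hf : f ∈ D.sobolev s)
    {M : ℝ} (hM : ∀ᵐ x, |f x| ≤ M) (hg : g =ᵐ[volume] fun x => f x ^ 2) :
    g ∈ D.sobolev s ∧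
      ‖D.fracDeriv s g‖ ^ 2 ≤ 4 * M ^ 2 * ((1 - (2 : ℝ) ^ (-2 * s))⁻¹ * ‖D.fracDeriv s f‖ ^ 2) := by
  have hq1 : (2 : ℝ) ^ (-2 * s) < 1 := two_rpow_lt_one (by linarith)
  have hK : 0 ≤ (1 - (2 : ℝ) ^ (-2 * s))⁻¹ := inv_nonneg.2 (by linarith)
  have hterm : ∀ I : D.intervals, (volume.real (I : Set ℝ) ^ (-s) * haarCoeff g I) ^ 2 ≤
      4 * M ^ 2 * ((volume.real (I : Set ℝ) ^ (-s)) ^ 2 * ‖oscillation f I‖ ^ 2) := by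
    intro I
    have h := pow_le_pow_left₀ (abs_nonneg _) (abs_haarCoeff_sq_le hM hg I) 2
    rw [sq_abs] at h
    calc (volume.real (I : Set ℝ) ^ (-s) * haarCoeff g I) ^ 2
        = (volume.real (I : Set ℝ) ^ (-s)) ^ 2 * haarCoeff g I ^ 2 := mul_pow _ _ _
      _ ≤ (volume.real (I : Set ℝ) ^ (-s)) ^ 2 * (2 * M * ‖oscillation f I‖) ^ 2 := by gcongr
      _ = _ := by ring
  obtain ⟨h1, h2⟩ := summable_and_tsum_le_of_tsum_ofReal_le
    (F := fun I : D.intervals => (volume.real (I : Set ℝ) ^ (-s) * haarCoeff g I) ^ 2)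
    (B := 4 * M ^ 2 * ((1 - (2 : ℝ) ^ (-2 * s))⁻¹ * ‖D.fracDeriv s f‖ ^ 2))
    (fun I => sq_nonneg _) (by positivity) <| by
      rw [ENNReal.ofReal_mul (by positivity)]
      refine (ENNReal.tsum_le_tsum fun I => ENNReal.ofReal_le_ofReal (hterm I)).trans ?_
      simp only [ENNReal.ofReal_mul (show 0 ≤ 4 * M ^ 2 by positivity)]
      rw [ENNReal.tsum_mul_left]
      gcongr
      exact tsum_weighted_oscillation_le hs hf
  have hmem : g ∈ D.sobolev s := (D.summable_fracDerivTerm_iff s g).2 h1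
  exact ⟨hmem, (hasSum_norm_fracDeriv_sq hmem).tsum_eq ▸ h2⟩

/-! ### The square in the Sobolev norm, and products. -/

theorem memLp_sq {f : Lp ℝ 2 (volume : Measure ℝ)} {M : ℝ} (hM : ∀ᵐ x, |f x| ≤ M) :
    MemLp (fun x => f x ^ 2) 2 volume := by
  refine MemLp.of_le_mul (c := M) (Lp.memLp f)
    ((Lp.aestronglyMeasurable f).pow 2) ?_
  filter_upwards [hM] with x hx
  rw [norm_pow, sq]
  gcongr
  exact hx

theorem norm_le_sobolevNorm (f : Lp ℝ 2 (volume : Measure ℝ)) : ‖f‖ ≤ D.sobolevNorm s f :=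
  Real.le_sqrt_of_sq_le (le_add_of_nonneg_left (sq_nonneg _))

theorem norm_fracDeriv_le_sobolevNorm (f : Lp ℝ 2 (volume : Measure ℝ)) :
    ‖D.fracDeriv s f‖ ≤ D.sobolevNorm s f :=
  Real.le_sqrt_of_sq_le (le_add_of_nonneg_right (sq_nonneg _))

theorem sobolevNorm_sq (f : Lp ℝ 2 (volume : Measure ℝ)) :
    D.sobolevNorm s f ^ 2 = ‖D.fracDeriv s f‖ ^ 2 + ‖f‖ ^ 2 :=
  Real.sq_sqrt (by positivity)

theorem exists_sq_mem_sobolev (hs : 1 / 2 < s) {f : Lp ℝ 2 (volume : Measure ℝ)}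
    (hf : f ∈ D.sobolev s) :
    ∃ g ∈ D.sobolev s, (g =ᵐ[volume] fun x => f x ^ 2) ∧
      D.sobolevNorm s g ≤ Real.sqrt (4 * (1 - (2 : ℝ) ^ (-2 * s))⁻¹ + 1) *
        (1 + (1 - (2 : ℝ) ^ (1 / 2 - s))⁻¹) * D.sobolevNorm s f ^ 2 := by
  have hq1 : (2 : ℝ) ^ (-2 * s) < 1 := two_rpow_lt_one (by linarith)
  have hr1 : (2 : ℝ) ^ (1 / 2 - s) < 1 := two_rpow_lt_one (by linarith)
  set K : ℝ := (1 - (2 : ℝ) ^ (-2 * s))⁻¹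
  set A : ℝ := 1 + (1 - (2 : ℝ) ^ (1 / 2 - s))⁻¹ with hA
  set N := D.sobolevNorm s f with hN
  have hK : 0 ≤ K := inv_nonneg.2 (by linarith)
  have hA' : 0 ≤ (1 - (2 : ℝ) ^ (1 / 2 - s))⁻¹ := inv_nonneg.2 (by linarith)
  have hA0 : 0 ≤ A := by positivity
  have hN0 : 0 ≤ N := Real.sqrt_nonneg _
  have hM : ∀ᵐ x, |f x| ≤ A * N := by
    filter_upwards [ae_abs_le hs hf] with x hx
    refine hx.trans ?_
    rw [hA, add_mul, one_mul]
    gcongr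
    · exact norm_le_sobolevNorm f
    · exact norm_fracDeriv_le_sobolevNorm f
  have hcoe := (memLp_sq hM).coeFn_toLp
  obtain ⟨hmem, hder⟩ := sq_mem_sobolev (by linarith) hf hM hcoe
  refine ⟨_, hmem, hcoe, ?_⟩
  have hnorm : ‖(memLp_sq hM).toLp _‖ ≤ A * N * ‖f‖ := by
    refine Lp.norm_le_mul_norm_of_ae_le_mul ?_
    filter_upwards [hcoe, hM] with x h1 h2
    rw [h1, norm_pow, sq]
    gcongr
    exact h2
  refine Real.sqrt_le_iff.2 ⟨by positivity, ?_⟩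
  have h1 := pow_le_pow_left₀ (norm_nonneg _) hnorm 2
  have h2 : N ^ 2 = ‖D.fracDeriv s f‖ ^ 2 + ‖f‖ ^ 2 := sobolevNorm_sq f
  calc _ ≤ 4 * (A * N) ^ 2 * (K * ‖D.fracDeriv s f‖ ^ 2) + (A * N * ‖f‖) ^ 2 := add_le_add hder h1
    -- The two discarded cross terms are nonnegative: `e1` and four times `e2`.
    _ ≤ (4 * K + 1) * A ^ 2 * N ^ 2 * (‖D.fracDeriv s f‖ ^ 2 + ‖f‖ ^ 2) := by
      have e1 : 0 ≤ A ^ 2 * N ^ 2 * ‖D.fracDeriv s f‖ ^ 2 := by positivity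
      have e2 : 0 ≤ K * (A ^ 2 * N ^ 2 * ‖f‖ ^ 2) := by positivity
      linarith
    _ = (Real.sqrt (4 * K + 1) * A * N ^ 2) ^ 2 := by
      rw [← h2, mul_pow, mul_pow, Real.sq_sqrt (by positivity)]
      ring

end DyadicGrid

theorem mainTheorem1 (s : ℝ) (hs : 1 / 2 < s) (hs1 : s < 1) :
    ∃ C : ℝ, 0 < C ∧ ∀ D : DyadicGrid,
      (∀ f ∈ D.sobolev s, ∃ g ∈ D.sobolev s,
        (g =ᵐ[volume] fun x => f x ^ 2) ∧ D.sobolevNorm s g ≤ C * D.sobolevNorm s f ^ 2) ∧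
      (∀ f₁ ∈ D.sobolev s, ∀ f₂ ∈ D.sobolev s, ∃ g ∈ D.sobolev s,
        g =ᵐ[volume] fun x => f₁ x * f₂ x) := by
  have hq1 : 0 < (1 - (2 : ℝ) ^ (-2 * s))⁻¹ :=
    inv_pos.2 (sub_pos.2 (DyadicGrid.two_rpow_lt_one (by linarith)))
  have hr1 : 0 < (1 - (2 : ℝ) ^ (1 / 2 - s))⁻¹ :=
    inv_pos.2 (sub_pos.2 (DyadicGrid.two_rpow_lt_one (by linarith)))
  refine ⟨Real.sqrt (4 * (1 - (2 : ℝ) ^ (-2 * s))⁻¹ + 1) *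
        (1 + (1 - (2 : ℝ) ^ (1 / 2 - s))⁻¹), by positivity, fun D =>
    ⟨fun f hf => DyadicGrid.exists_sq_mem_sobolev hs hf, fun f₁ h₁ f₂ h₂ => ?_⟩⟩
  -- Polarization: `f₁ f₂ = ((f₁ + f₂)² - f₁² - f₂²) / 2`.
  obtain ⟨g, hg, hgf, -⟩ := DyadicGrid.exists_sq_mem_sobolev hs (add_mem h₁ h₂)
  obtain ⟨g₁, hg₁, hgf₁, -⟩ := DyadicGrid.exists_sq_mem_sobolev hs h₁
  obtain ⟨g₂, hg₂, hgf₂, -⟩ := DyadicGrid.exists_sq_mem_sobolev hs h₂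
  refine ⟨(1 / 2 : ℝ) • (g - g₁ - g₂),
    (D.sobolev s).smul_mem _ (sub_mem (sub_mem hg hg₁) hg₂), ?_⟩
  filter_upwards [hgf, hgf₁, hgf₂, Lp.coeFn_add f₁ f₂, Lp.coeFn_sub g g₁,
    Lp.coeFn_sub (g - g₁) g₂, Lp.coeFn_smul (1 / 2 : ℝ) (g - g₁ - g₂)] with x e e₁ e₂ e₃ e₄ e₅ e₆
  rw [e₆, Pi.smul_apply, e₅, Pi.sub_apply, e₄, Pi.sub_apply, e, e₁, e₂, e₃, Pi.add_apply,
    smul_eq_mul]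
  ring
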